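/- Let $A$ be a finite set of items and let $\mathcal F$ be an antimonotonic family of subsets of $A$ (every subset of a member of $\mathcal F$ is a member of $\mathcal F$). For $U \subseteq A$ let $S_U : \{0,1\}^A \to \{0,1\}$ be the indicator function with $S_U(z) = 1$ if and only if $z_i = 1$ for all $i \in U$. A vector $\theta = (\theta_U)_{U \in \mathcal F}$ of real numbers is called a vector of frequencies for $\mathcal F$ if there is a probability distribution $p$ on $\{0,1\}^A$ that satisfies $\theta$, that is, $\mathbb E_p[S_U] = \theta_U$ for all $U \in \mathcal F$. A set $C \subseteq A$ is called safe if for every vector $\theta$ of frequencies for $\mathcal F$ and every probability distribution $q$ on $\{0,1\}^C$ with $\mathbb E_q[S_U] = \theta_U$ for all $U \in \mathcal F$ with $U \subseteq C$, there is a probability distribution $p$ on $\{0,1\}^A$ that satisfies $\theta$ and whose marginal distribution on $\{0,1\}^C$ is $q$. Then for every $B \subseteq A$ there is exactly one safe set containing $B$ that has the minimum number of items among all safe sets containing $B$. Moreover, this set is contained in every safe set containing $B$. -/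

import Mathlib

/-! Items are the elements of a finite type `ι`; an itemset is a `Finset ι`; a distribution on
binary vectors indexed by `ι` is an element of `stdSimplex ℝ (ι → Bool)`. -/

/-- Every subset of a member is a member. -/
def IsAntimonotonic {ι : Type*} (F : Set (Finset ι)) : Prop :=
  ∀ U ∈ F, ∀ V : Finset ι, V ⊆ U → V ∈ F

/-- The itemset indicator function `S_U`. -/
def itemsetIndicator {ι : Type*} (U : Finset ι) (z : ι → Bool) : ℝ :=
  if ∀ i ∈ U, z i = true then 1 else 0

/-- The mean of `g` with respect to `p`. -/
def distMean {ι : Type*} [Fintype ι] [DecidableEq ι]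
    (p : (ι → Bool) → ℝ) (g : (ι → Bool) → ℝ) : ℝ :=
  ∑ z, p z * g z

/-- The distribution `p` satisfies the frequencies `θ` for the family `F`. -/
def Satisfies {ι : Type*} [Fintype ι] [DecidableEq ι]
    (F : Set (Finset ι)) (θ : F → ℝ) (p : (ι → Bool) → ℝ) : Prop :=
  ∀ U : F, distMean p (itemsetIndicator U.1) = θ U

/-- `θ` is a vector of frequencies for `F`: it is attained by some distribution. -/
def IsFrequencyVector {ι : Type*} [Fintype ι] [DecidableEq ι]
    (F : Set (Finset ι)) (θ : F → ℝ) : Prop :=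
  ∃ p ∈ stdSimplex ℝ (ι → Bool), Satisfies F θ p

/-- The members of `F` contained in `C`, viewed as itemsets over the item set `C`. -/
def projFamily {ι : Type*} (C : Finset ι) (F : Set (Finset ι)) : Set (Finset C) :=
  {V | V.map (Function.Embedding.subtype (· ∈ C)) ∈ F}

/-- The frequencies of the members of `F` contained in `C`. -/
def projFreq {ι : Type*} (C : Finset ι) {F : Set (Finset ι)} (θ : F → ℝ) :
    projFamily C F → ℝ :=
  fun V => θ ⟨V.1.map (Function.Embedding.subtype (· ∈ C)), V.2⟩

/-- The marginalisation of `p` to `C`. -/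
def marginal {ι : Type*} [Fintype ι] [DecidableEq ι] (C : Finset ι)
    (p : (ι → Bool) → ℝ) : (C → Bool) → ℝ :=
  fun w => ∑ z : ι → Bool, if (fun i : C => z i) = w then p z else 0

/-- `C` is `θ`-safe. -/
def IsThetaSafe {ι : Type*} [Fintype ι] [DecidableEq ι]
    (F : Set (Finset ι)) (θ : F → ℝ) (C : Finset ι) : Prop :=
  ∀ q ∈ stdSimplex ℝ (C → Bool), Satisfies (projFamily C F) (projFreq C θ) q →
    ∃ p ∈ stdSimplex ℝ (ι → Bool), marginal C p = q ∧ Satisfies F θ p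

/-- `C` is safe: it is `θ`-safe for all frequencies `θ` for `F`. -/
def IsSafe {ι : Type*} [Fintype ι] [DecidableEq ι]
    (F : Set (Finset ι)) (C : Finset ι) : Prop :=
  ∀ θ : F → ℝ, IsFrequencyVector F θ → IsThetaSafe F θ C

/-- `C` is a safe set containing `B` with the minimum number of items. -/
def IsMinimumSafe {ι : Type*} [Fintype ι] [DecidableEq ι]
    (F : Set (Finset ι)) (B C : Finset ι) : Prop :=
  B ⊆ C ∧ IsSafe F C ∧ ∀ Y : Finset ι, B ⊆ Y → IsSafe F Y → C.card ≤ Y.card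

/-!
Safe sets are closed under intersection, so a safe set of minimum size containing `B` lies in every
other safe set containing `B`, and is therefore unique.

Closure under intersection is clear only after safety has been made combinatorial. Join two items
by an edge when the pair is in `F`. Then `C` is safe if and only if, for every connected component
of the complement of `C`, the items of `C` adjacent to that component form a member of `F` (or there
are none); this is `HasBoundariesIn`, and the equivalence is `isSafe_iff_hasBoundariesIn`.

* If the boundaries are in `F`, the frequencies determine the marginal on each boundary, so a given
  distribution on `C` and a distribution satisfying `θ` agree there and can be glued, conditionally
  independently, one component at a time (`exists_glue`, `HasBoundariesIn.exists_extension`). Every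
  member of `F` is a clique, hence lies in `C` or in one component with its boundary, and receives
  the right frequency.
* If some boundary is not in `F`, the uniform distributions on its subsets of even and of odd
  codimension have the same frequencies on all proper subsets. Pair frequencies can force the items
  of the component to be equal to the indicator of the whole boundary, and this excludes the odd
  distribution (`IsSafe.mem_of_avoidReach`).

The boundary condition passes to `C ∩ D` because boundaries of components outside `C` are cliques:
a path avoiding `C ∩ D` can be shortcut through `C` past its detours outside `C`, and then avoids `D`
(`AvoidReach.reroute`, `HasBoundariesIn.inter`).
-/

/-! ### Paths that avoid a set -/

/-- `AvoidReach F C a b` says that `b` is the end of a path starting at `a`, in the graph whose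
edges are the pairs in `F`, all of whose vertices other than `b` lie outside `C`. The trivial path
is allowed, so `AvoidReach F C a a` always holds. -/
def AvoidReach {ι : Type*} [DecidableEq ι] (F : Set (Finset ι)) (C : Finset ι) : ι → ι → Prop :=
  Relation.ReflTransGen fun a b => a ∉ C ∧ ({a, b} : Finset ι) ∈ F

/-- The combinatorial form of safety: the items of `C` that border a common connected component
of the complement of `C` form a member of `F`. The component is given by one of its items `h`, and
the condition is imposed on every nonempty set of bordering items, which for antimonotonic `F` is
the same as imposing it on the whole boundary. An empty boundary is allowed even if `∅ ∉ F`. -/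
def HasBoundariesIn {ι : Type*} [DecidableEq ι] (F : Set (Finset ι)) (C : Finset ι) : Prop :=
  ∀ h ∉ C, ∀ N ⊆ C, N.Nonempty → (∀ n ∈ N, AvoidReach F C h n) → N ∈ F

section Paths

variable {ι : Type*} [DecidableEq ι] {F : Set (Finset ι)} {C D : Finset ι}

theorem AvoidReach.mono (hDC : D ⊆ C) {a b : ι} (h : AvoidReach F C a b) :
    AvoidReach F D a b :=
  Relation.ReflTransGen.mono (fun _ _ hab => ⟨fun hD => hab.1 (hDC hD), hab.2⟩) _ _ h

theorem AvoidReach.tail {a b c : ι} (h : AvoidReach F C a b) (hb : b ∉ C)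
    (hbc : ({b, c} : Finset ι) ∈ F) : AvoidReach F C a c :=
  Relation.ReflTransGen.tail h ⟨hb, hbc⟩

theorem AvoidReach.head {a b c : ι} (ha : a ∉ C) (hab : ({a, b} : Finset ι) ∈ F)
    (h : AvoidReach F C b c) : AvoidReach F C a c :=
  Relation.ReflTransGen.head ⟨ha, hab⟩ h

theorem AvoidReach.single {a b : ι} (ha : a ∉ C) (hab : ({a, b} : Finset ι) ∈ F) :
    AvoidReach F C a b :=
  Relation.ReflTransGen.single ⟨ha, hab⟩

/-- A path can be reversed once its last vertex is also outside the avoided set. -/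
theorem AvoidReach.symm (hDC : D ⊆ C) {a b : ι} (h : AvoidReach F C a b) (hb : b ∉ D) :
    AvoidReach F D b a := by
  induction h with
  | refl => exact Relation.ReflTransGen.refl
  | tail _ hxy ih =>
    refine AvoidReach.head hb ?_ (ih fun hD => hxy.1 (hDC hD))
    rw [Finset.pair_comm]
    exact hxy.2

theorem HasBoundariesIn.pair_mem (hC : HasBoundariesIn F C) {h a b : ι} (hh : h ∉ C)
    (ha : a ∈ C) (hb : b ∈ C) (hha : AvoidReach F C h a) (hhb : AvoidReach F C h b) :
    ({a, b} : Finset ι) ∈ F := by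
  refine hC h hh _ ?_ ⟨a, by simp⟩ ?_
  · intro x hx
    rcases Finset.mem_insert.1 hx with rfl | hx
    · exact ha
    · rw [Finset.mem_singleton.1 hx]; exact hb
  · intro x hx
    rcases Finset.mem_insert.1 hx with rfl | hx
    · exact hha
    · rw [Finset.mem_singleton.1 hx]; exact hhb

/-- A path between points of `C` that avoids `C ∩ D` can be rerouted to avoid `D`: each detour
outside `C` leaves and re-enters `C` at two items bordering the same component, which are
joined by an edge. The second alternative keeps track of a detour in progress, `y` being the
item at which it left `C`. -/
theorem AvoidReach.reroute_aux (hC : HasBoundariesIn F C) {h x : ι} (hh : h ∈ C)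
    (hx : AvoidReach F (C ∩ D) h x) :
    (x ∈ C ∧ AvoidReach F D h x) ∨
      (x ∉ C ∧ ∃ y ∈ C, y ∉ D ∧ AvoidReach F D h y ∧ AvoidReach F C x y) := by
  induction hx with
  | refl => exact Or.inl ⟨hh, Relation.ReflTransGen.refl⟩
  | @tail a b _ hab ih =>
    obtain ⟨haCD, hab⟩ := hab
    have hba : ({b, a} : Finset ι) ∈ F := by rwa [Finset.pair_comm]
    rcases ih with ⟨haC, hha⟩ | ⟨haC, y, hyC, hyD, hhy, hay⟩
    · have haD : a ∉ D := fun hD => haCD (Finset.mem_inter.2 ⟨haC, hD⟩)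
      by_cases hbC : b ∈ C
      · exact Or.inl ⟨hbC, hha.tail haD hab⟩
      · exact Or.inr ⟨hbC, a, haC, haD, hha, AvoidReach.single hbC hba⟩
    · by_cases hbC : b ∈ C
      · exact Or.inl ⟨hbC, hhy.tail hyD
          (hC.pair_mem haC hyC hbC hay (AvoidReach.single haC hab))⟩
      · exact Or.inr ⟨hbC, y, hyC, hyD, hhy, AvoidReach.head hbC hba hay⟩

theorem AvoidReach.reroute (hC : HasBoundariesIn F C) {h x : ι} (hh : h ∈ C) (hx : x ∈ C)
    (hhx : AvoidReach F (C ∩ D) h x) : AvoidReach F D h x := by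
  rcases hhx.reroute_aux hC hh with ⟨_, h⟩ | ⟨h, _⟩
  · exact h
  · exact absurd hx h

/-- A path avoiding `C ∩ D` either avoids `C` altogether or meets `C` for the first time at a
point outside `D`. -/
theorem AvoidReach.avoid_or_meet {h n : ι} (hn : AvoidReach F (C ∩ D) h n) :
    AvoidReach F C h n ∨ ∃ c ∈ C, c ∉ D ∧ AvoidReach F C h c := by
  induction hn with
  | refl => exact Or.inl Relation.ReflTransGen.refl
  | @tail a b _ hab ih =>
    rcases ih with ha | hc
    · by_cases haC : a ∈ C
      · exact Or.inr ⟨a, haC, fun hD => hab.1 (Finset.mem_inter.2 ⟨haC, hD⟩), ha⟩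
      · exact Or.inl (ha.tail haC hab.2)
    · exact Or.inr hc

theorem HasBoundariesIn.inter (hC : HasBoundariesIn F C) (hD : HasBoundariesIn F D) :
    HasBoundariesIn F (C ∩ D) := by
  intro h hh N hN hne hreach
  have hNC : N ⊆ C := hN.trans Finset.inter_subset_left
  have hND : N ⊆ D := hN.trans Finset.inter_subset_right
  by_cases hhC : h ∈ C
  · have hhD : h ∉ D := fun hD => hh (Finset.mem_inter.2 ⟨hhC, hD⟩)
    exact hD h hhD N hND hne fun n hn => (hreach n hn).reroute hC hhC (hNC hn)
  · by_cases hc : ∃ c ∈ C, c ∉ D ∧ AvoidReach F C h c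
    · obtain ⟨c, hcC, hcD, hhc⟩ := hc
      have hch : AvoidReach F (C ∩ D) c h :=
        hhc.symm Finset.inter_subset_left fun h => hcD (Finset.mem_inter.1 h).2
      exact hD c hcD N hND hne fun n hn =>
        AvoidReach.reroute hC hcC (hNC hn) (Relation.ReflTransGen.trans hch (hreach n hn))
    · exact hC h hhC N hNC hne fun n hn => (hreach n hn).avoid_or_meet.resolve_right hc

/-- Adjoining a whole component of the complement (with the items bordering it, which are already
in `C`) leaves the other components and their boundaries unchanged. -/
theorem HasBoundariesIn.union_component (hC : HasBoundariesIn F C) {h : ι} {T : Finset ι}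
    (hT : ∀ x, x ∈ T ↔ AvoidReach F C h x) : HasBoundariesIn F (C ∪ T) := by
  intro k hk N hN hne hreach
  refine hC k (fun hkC => hk (Finset.mem_union_left _ hkC)) N ?_ hne
    fun n hn => (hreach n hn).mono Finset.subset_union_left
  intro n hn
  by_contra hnC
  have hnT : n ∈ T := (Finset.mem_union.1 (hN hn)).resolve_left hnC
  rcases Relation.ReflTransGen.cases_tail (hreach n hn) with hkn | ⟨a, _, haC, han⟩
  · exact hk (hkn ▸ Finset.mem_union_right _ hnT)
  · refine haC (Finset.mem_union_right _ ((hT a).2 (((hT n).1 hnT).tail hnC ?_)))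
    rwa [Finset.pair_comm]

end Paths

/-! ### Means, push-forwards and marginals -/

section Means

variable {ι : Type*} [Fintype ι] [DecidableEq ι]

theorem itemsetIndicator_nonneg {ι : Type*} (U : Finset ι) (z : ι → Bool) :
    0 ≤ itemsetIndicator U z := by
  unfold itemsetIndicator
  split_ifs <;> norm_num

theorem itemsetIndicator_empty {ι : Type*} (z : ι → Bool) : itemsetIndicator ∅ z = 1 := by
  simp [itemsetIndicator]

theorem itemsetIndicator_dependsOn {ι : Type*} {U S : Finset ι} (hU : U ⊆ S) :
    DependsOn (itemsetIndicator U) (S : Set ι) := by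
  intro x y hxy
  have : (∀ i ∈ U, x i = true) ↔ ∀ i ∈ U, y i = true :=
    forall₂_congr fun i hi => by rw [hxy i (hU hi)]
  simp only [itemsetIndicator, this]

theorem distMean_indicator_empty {p : (ι → Bool) → ℝ} (hp : p ∈ stdSimplex ℝ (ι → Bool)) :
    distMean p (itemsetIndicator ∅) = 1 := by
  simp [distMean, itemsetIndicator_empty, hp.2]

/-- Push-forward: a weighted family of points defines a distribution. -/
theorem exists_pushforward {α : Type*} (s : Finset α) (w : α → ℝ) (hw : ∀ a ∈ s, 0 ≤ w a)
    (hsum : ∑ a ∈ s, w a = 1) (Φ : α → ι → Bool) :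
    ∃ p ∈ stdSimplex ℝ (ι → Bool), ∀ f, distMean p f = ∑ a ∈ s, w a * f (Φ a) := by
  have key : ∀ f : (ι → Bool) → ℝ,
      distMean (fun z => ∑ a ∈ s, if Φ a = z then w a else 0) f = ∑ a ∈ s, w a * f (Φ a) := by
    intro f
    simp only [distMean, Finset.sum_mul]
    rw [Finset.sum_comm]
    refine Finset.sum_congr rfl fun a _ => ?_
    simp
  refine ⟨_, ⟨fun z => Finset.sum_nonneg fun a ha => ?_, ?_⟩, key⟩
  · split_ifs
    exacts [hw a ha, le_rfl]
  · simpa [distMean, hsum] using key fun _ => 1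

theorem marginal_apply (C : Finset ι) (p : (ι → Bool) → ℝ) (w : C → Bool) :
    marginal C p w = distMean p fun z => if (fun i : C => z i) = w then 1 else 0 := by
  simp [marginal, distMean]

theorem distMean_marginal (C : Finset ι) (p : (ι → Bool) → ℝ) (g : (C → Bool) → ℝ) :
    distMean (marginal C p) g = distMean p fun z => g fun i : C => z i := by
  simp only [distMean, marginal, Finset.sum_mul]
  rw [Finset.sum_comm]
  refine Finset.sum_congr rfl fun z _ => ?_
  simp

theorem itemsetIndicator_map {C : Finset ι} (V : Finset C) (z : ι → Bool) :
    itemsetIndicator (V.map (Function.Embedding.subtype (· ∈ C))) z =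
      itemsetIndicator V fun i : C => z i := by
  simp [itemsetIndicator]

/-- Two distributions whose itemset frequencies agree on the subsets of `N ∪ V` give the same mean
to `f * S_V` for every `f` that depends on `N` only, since such an `f` is a linear combination
of the functions `S_U`, `U ⊆ N`. -/
theorem distMean_mul_indicator_eq (p p₀ : (ι → Bool) → ℝ) (N : Finset ι) :
    ∀ V : Finset ι,
      (∀ U ⊆ N ∪ V, distMean p (itemsetIndicator U) = distMean p₀ (itemsetIndicator U)) →
      ∀ f : (ι → Bool) → ℝ, DependsOn f (N : Set ι) →
        distMean p (fun z => f z * itemsetIndicator V z) =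
          distMean p₀ (fun z => f z * itemsetIndicator V z) := by
  induction N using Finset.induction_on with
  | empty =>
    intro V hV f hf
    have hc : ∀ z, f z = f fun _ => false := fun z => hf (by simp)
    have hp : ∀ p' : (ι → Bool) → ℝ, distMean p' (fun z => f z * itemsetIndicator V z) =
        (f fun _ => false) * distMean p' (itemsetIndicator V) := by
      intro p'
      simp only [distMean, Finset.mul_sum]
      exact Finset.sum_congr rfl fun z _ => by rw [hc z]; ring
    rw [hp, hp, hV V (by simp)]
  | insert a N _ ih =>
    intro V hV f hf
    -- `f z = g₀ z + g₁ z * z a`, where `g₀` and `g₁` do not depend on the coordinate `a`.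
    have hdep : ∀ b, DependsOn (fun z => f (Function.update z a b)) (N : Set ι) := by
      intro b x y hxy
      refine hf fun i hi => ?_
      rcases eq_or_ne i a with rfl | hia
      · simp
      · have : i ∈ N := (Finset.mem_insert.1 (Finset.mem_coe.1 hi)).resolve_left hia
        simpa [Function.update_of_ne hia] using hxy i this
    have hsplit : ∀ z, f z * itemsetIndicator V z =
        f (Function.update z a false) * itemsetIndicator V z +
          (f (Function.update z a true) - f (Function.update z a false)) *
            itemsetIndicator (insert a V) z := by
      intro z
      have hz : Function.update z a (z a) = z := Function.update_eq_self a z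
      cases hza : z a <;> rw [hza] at hz
      · simp [itemsetIndicator, hza, hz]
      · simp only [itemsetIndicator, Finset.forall_mem_insert, hza, hz, true_and]
        split_ifs <;> ring
    have hmean : ∀ p' : (ι → Bool) → ℝ, distMean p' (fun z => f z * itemsetIndicator V z) =
        distMean p' (fun z => f (Function.update z a false) * itemsetIndicator V z) +
          distMean p' (fun z =>
            (f (Function.update z a true) - f (Function.update z a false)) *
              itemsetIndicator (insert a V) z) := by
      intro p'
      simp only [distMean, ← Finset.sum_add_distrib, ← mul_add, ← hsplit]
    rw [hmean, hmean]
    congr 1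
    · refine ih V (fun U hU => hV U (hU.trans ?_)) _ (hdep false)
      exact Finset.union_subset_union_left (Finset.subset_insert a N)
    · refine ih (insert a V) (fun U hU => hV U (hU.trans ?_)) _ fun x y hxy => ?_
      · rw [Finset.union_insert, Finset.insert_union]
      · have h1 := hdep true hxy
        have h0 := hdep false hxy
        simp only at h0 h1
        simp only [h0, h1]

theorem distMean_eq_of_dependsOn {p p₀ : (ι → Bool) → ℝ} {N : Finset ι}
    (h : ∀ U ⊆ N, distMean p (itemsetIndicator U) = distMean p₀ (itemsetIndicator U))
    {f : (ι → Bool) → ℝ} (hf : DependsOn f (N : Set ι)) : distMean p f = distMean p₀ f := by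
  simpa [itemsetIndicator_empty] using
    distMean_mul_indicator_eq p p₀ N ∅ (by simpa using h) f hf

/-- The mass that a distribution gives to the vectors agreeing with `x` on `N`. -/
noncomputable def cylinderMass (N : Finset ι) (p : (ι → Bool) → ℝ) (x : ι → Bool) : ℝ :=
  distMean p fun y => if ∀ i ∈ N, x i = y i then 1 else 0

theorem le_cylinderMass (N : Finset ι) {p : (ι → Bool) → ℝ} (hp : ∀ z, 0 ≤ p z)
    (x : ι → Bool) : p x ≤ cylinderMass N p x := by
  have : p x * (if ∀ i ∈ N, x i = x i then 1 else 0) ≤ cylinderMass N p x :=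
    Finset.single_le_sum (f := fun y => p y * (if ∀ i ∈ N, x i = y i then 1 else 0))
      (fun y _ => mul_nonneg (hp y) (by split_ifs <;> norm_num)) (Finset.mem_univ x)
  simpa using this

/-- Conditioning the second factor on agreement over `N` and integrating it out leaves the first
factor unchanged; where the cylinder mass vanishes, so does `p x`, and division by zero is
harmless. -/
theorem sum_coupling (N : Finset ι) {p p₀ : (ι → Bool) → ℝ} (hp : ∀ z, 0 ≤ p z)
    (hN : ∀ x, cylinderMass N p x = cylinderMass N p₀ x) (x : ι → Bool) :
    ∑ y, p x * p₀ y * (if ∀ i ∈ N, x i = y i then 1 else 0) / cylinderMass N p x = p x := by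
  have h1 : ∑ y, p x * p₀ y * (if ∀ i ∈ N, x i = y i then 1 else 0) / cylinderMass N p x =
      p x * cylinderMass N p₀ x / cylinderMass N p x := by
    rw [← Finset.sum_div]
    simp only [cylinderMass, distMean, Finset.mul_sum, mul_assoc]
  rw [h1, ← hN]
  rcases eq_or_ne (cylinderMass N p x) 0 with h | h
  · have := le_cylinderMass N hp x
    have := hp x
    rw [h]
    simp only [mul_zero, zero_div]
    linarith
  · exact mul_div_cancel_right₀ _ h

/-- Gluing: if `p` and `p₀` have the same marginal on `S ∩ T`, some distribution has the marginal of
`p` on `S` and that of `p₀` on `T`, namely the one that makes the two parts conditionally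
independent given `S ∩ T`. Equality of marginals on a set is expressed as equality of the means of
all functions that depend on that set only. -/
theorem exists_glue {p p₀ : (ι → Bool) → ℝ} (hp : p ∈ stdSimplex ℝ (ι → Bool))
    (hp₀ : p₀ ∈ stdSimplex ℝ (ι → Bool)) (S T : Finset ι)
    (h : ∀ f : (ι → Bool) → ℝ, DependsOn f ((S ∩ T : Finset ι) : Set ι) →
      distMean p f = distMean p₀ f) :
    ∃ p' ∈ stdSimplex ℝ (ι → Bool),
      (∀ f : (ι → Bool) → ℝ, DependsOn f (S : Set ι) → distMean p' f = distMean p f) ∧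
        ∀ f : (ι → Bool) → ℝ, DependsOn f (T : Set ι) → distMean p' f = distMean p₀ f := by
  set N := S ∩ T with hNdef
  have hN : ∀ x, cylinderMass N p x = cylinderMass N p₀ x := by
    intro x
    refine h _ fun y y' hyy => ?_
    have : (∀ i ∈ N, x i = y i) ↔ ∀ i ∈ N, x i = y' i :=
      forall₂_congr fun i hi => by rw [hyy i hi]
    simp only [this]
  let r : (ι → Bool) × (ι → Bool) → ℝ := fun u =>
    p u.1 * p₀ u.2 * (if ∀ i ∈ N, u.1 i = u.2 i then 1 else 0) / cylinderMass N p u.1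
  let Φ : (ι → Bool) × (ι → Bool) → ι → Bool := fun u i => if i ∈ S then u.1 i else u.2 i
  have hr : ∀ u, 0 ≤ r u := fun u =>
    div_nonneg (mul_nonneg (mul_nonneg (hp.1 _) (hp₀.1 _)) (by split_ifs <;> norm_num))
      ((hp.1 _).trans (le_cylinderMass N hp.1 _))
  have hfst : ∀ x, ∑ y, r (x, y) = p x := sum_coupling N hp.1 hN
  -- On the support of `r` the points agree on `N`, so the mass may be taken at either of them.
  have hsymm : ∀ x y, r (x, y) =
      p₀ y * p x * (if ∀ i ∈ N, y i = x i then 1 else 0) / cylinderMass N p₀ y := by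
    intro x y
    simp only [r]
    by_cases hxy : ∀ i ∈ N, x i = y i
    · have hm : cylinderMass N p₀ x = cylinderMass N p₀ y := by
        unfold cylinderMass
        congr 1
        funext z
        have : (∀ i ∈ N, x i = z i) ↔ ∀ i ∈ N, y i = z i :=
          forall₂_congr fun i hi => by rw [hxy i hi]
        simp only [this]
      rw [if_pos hxy, if_pos fun i hi => (hxy i hi).symm, hN, hm, mul_comm (p x)]
    · rw [if_neg hxy, if_neg fun hyx => hxy fun i hi => (hyx i hi).symm]
      simp
  have hsnd : ∀ y, ∑ x, r (x, y) = p₀ y := by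
    intro y
    simp only [hsymm]
    exact sum_coupling N hp₀.1 (fun x => (hN x).symm) y
  have hsum : ∑ u, r u = 1 := by
    rw [Fintype.sum_prod_type]
    simp only [hfst, hp.2]
  obtain ⟨p', hp', hmean⟩ := exists_pushforward Finset.univ r (fun u _ => hr u) hsum Φ
  refine ⟨p', hp', fun f hf => ?_, fun f hf => ?_⟩
  · have hΦ : ∀ u, f (Φ u) = f u.1 := fun u => hf fun i hi => by
      simp [Φ, Finset.mem_coe.1 hi]
    rw [hmean, Fintype.sum_prod_type]
    simp only [hΦ, ← Finset.sum_mul, hfst, distMean]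
  · have hΦ : ∀ u, r u * f (Φ u) = r u * f u.2 := by
      intro u
      by_cases hu : ∀ i ∈ N, u.1 i = u.2 i
      · congr 1
        refine hf fun i hi => ?_
        by_cases hiS : i ∈ S
        · simp only [Φ, hiS, if_true]
          exact hu i (Finset.mem_inter.2 ⟨hiS, hi⟩)
        · simp [Φ, hiS]
      · simp [r, hu]
    rw [hmean, Fintype.sum_prod_type_right]
    simp only [hΦ, ← Finset.sum_mul, hsnd, distMean]

end Means

/-! ### Boundaries in the family imply safety -/

section Sufficiency

variable {ι : Type*} [Fintype ι] [DecidableEq ι] {F : Set (Finset ι)}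

/-- A distribution with the right frequencies inside `C` can be changed outside `C` so that all
frequencies are right. Each step glues in, along its boundary, one component of the complement
taken from a distribution `p₀` that satisfies all the frequencies. -/
theorem HasBoundariesIn.exists_extension (hF : IsAntimonotonic F) {p₀ : (ι → Bool) → ℝ}
    (hp₀ : p₀ ∈ stdSimplex ℝ (ι → Bool)) (C : Finset ι) (hC : HasBoundariesIn F C)
    (p : (ι → Bool) → ℝ) (hp : p ∈ stdSimplex ℝ (ι → Bool))
    (hpC : ∀ U ∈ F, U ⊆ C → distMean p (itemsetIndicator U) = distMean p₀ (itemsetIndicator U)) :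
    ∃ p' ∈ stdSimplex ℝ (ι → Bool),
      (∀ f : (ι → Bool) → ℝ, DependsOn f (C : Set ι) → distMean p' f = distMean p f) ∧
        ∀ U ∈ F, distMean p' (itemsetIndicator U) = distMean p₀ (itemsetIndicator U) := by
  classical
  by_cases hall : ∀ h, h ∈ C
  · exact ⟨p, hp, fun _ _ => rfl, fun U hU => hpC U hU fun i _ => hall i⟩
  push Not at hall
  obtain ⟨h, hh⟩ := hall
  let T : Finset ι := Finset.univ.filter fun x => AvoidReach F C h x
  have hT : ∀ x, x ∈ T ↔ AvoidReach F C h x := fun x => by simp [T]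
  have hhT : h ∈ T := (hT h).2 Relation.ReflTransGen.refl
  have hagree : ∀ U ⊆ C ∩ T,
      distMean p (itemsetIndicator U) = distMean p₀ (itemsetIndicator U) := by
    intro U hU
    rcases U.eq_empty_or_nonempty with rfl | hne
    · rw [distMean_indicator_empty hp, distMean_indicator_empty hp₀]
    · have hUC : U ⊆ C := hU.trans Finset.inter_subset_left
      exact hpC U (hC h hh U hUC hne fun n hn => (hT n).1 (Finset.mem_inter.1 (hU hn)).2) hUC
  obtain ⟨p₁, hp₁, hp₁C, hp₁T⟩ :=
    exists_glue hp hp₀ C T fun f hf => distMean_eq_of_dependsOn hagree hf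
  -- A member of `F` inside `C ∪ T` that leaves `C` is a clique through the new component.
  have hp₁F : ∀ U ∈ F, U ⊆ C ∪ T →
      distMean p₁ (itemsetIndicator U) = distMean p₀ (itemsetIndicator U) := by
    intro U hU hUCT
    by_cases hUC : U ⊆ C
    · rw [hp₁C _ (itemsetIndicator_dependsOn hUC), hpC U hU hUC]
    · obtain ⟨x, hxU, hxC⟩ := Finset.not_subset.1 hUC
      have hxT : AvoidReach F C h x := (hT x).1 ((Finset.mem_union.1 (hUCT hxU)).resolve_left hxC)
      refine hp₁T _ (itemsetIndicator_dependsOn fun u hu => (hT u).2 (hxT.tail hxC ?_))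
      refine hF U hU _ fun y hy => ?_
      rcases Finset.mem_insert.1 hy with rfl | hy
      · exact hxU
      · rw [Finset.mem_singleton.1 hy]; exact hu
  have hlt : Finset.card (C ∪ T)ᶜ < Finset.card Cᶜ := by
    refine Finset.card_lt_card (Finset.ssubset_iff_of_subset ?_ |>.2 ⟨h, ?_, ?_⟩)
    · exact Finset.compl_subset_compl.2 Finset.subset_union_left
    · simpa using hh
    · simp [hhT]
  obtain ⟨p', hp', hdep, hfin⟩ := HasBoundariesIn.exists_extension hF hp₀ (C ∪ T)
    (hC.union_component hT) p₁ hp₁ hp₁F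
  refine ⟨p', hp', fun f hf => ?_, hfin⟩
  rw [hdep f (hf.mono (Finset.coe_subset.2 Finset.subset_union_left)), hp₁C f hf]
termination_by Finset.card Cᶜ
decreasing_by exact hlt

theorem HasBoundariesIn.isSafe (hF : IsAntimonotonic F) {C : Finset ι}
    (hC : HasBoundariesIn F C) : IsSafe F C := by
  rintro θ ⟨p₀, hp₀, hθ⟩ q hq hqθ
  let ext : (C → Bool) → ι → Bool := fun w i => if hi : i ∈ C then w ⟨i, hi⟩ else false
  have hext : ∀ w, (fun i : C => ext w i) = w := fun w => by
    funext i
    simp [ext]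
  obtain ⟨p, hp, hpq⟩ := exists_pushforward Finset.univ q (fun w _ => hq.1 w) hq.2 ext
  have hpC : ∀ U ∈ F, U ⊆ C →
      distMean p (itemsetIndicator U) = distMean p₀ (itemsetIndicator U) := by
    intro U hU hUC
    have hV : (U.subtype (· ∈ C)).map (Function.Embedding.subtype (· ∈ C)) = U :=
      Finset.subtype_map_of_mem hUC
    have hVF : U.subtype (· ∈ C) ∈ projFamily C F := by
      change _ ∈ F
      rwa [hV]
    have h1 := hqθ ⟨_, hVF⟩
    have h2 := hθ ⟨_, hVF⟩
    simp only [projFreq] at h1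
    simp only [hV] at h1 h2
    have hind : ∀ w, itemsetIndicator U (ext w) = itemsetIndicator (U.subtype (· ∈ C)) w := by
      intro w
      conv_lhs => rw [← hV]
      rw [itemsetIndicator_map, hext]
    rw [hpq, h2, ← h1]
    simp only [hind, distMean]
  obtain ⟨p', hp', hdep, hfin⟩ := hC.exists_extension hF hp₀ C p hp hpC
  refine ⟨p', hp', ?_, fun U => (hfin U U.2).trans (hθ U)⟩
  funext w
  rw [marginal_apply, hdep, hpq]
  · simp [hext]
  · intro x y hxy
    have : (fun i : C => x i) = fun i : C => y i := funext fun i => hxy i i.2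
    simp only [this]

end Sufficiency

/-! ### Safety implies boundaries in the family -/

section Necessity

/-- The signed sum of `S_U` over the subsets of `M` vanishes unless `U = M`: toggling an element of
`M \ U` is a sign-reversing involution. -/
theorem sum_powerset_sign_superset {ι : Type*} [DecidableEq ι] {M U : Finset ι} (hUM : U ≠ M) :
    ∑ X ∈ M.powerset, (-1 : ℝ) ^ (M \ X).card * (if U ⊆ X then 1 else 0) = 0 := by
  by_cases hMU : M ⊆ U
  · refine Finset.sum_eq_zero fun X hX => ?_
    rw [if_neg, mul_zero]
    intro hUX
    exact hUM ((hUX.trans (Finset.mem_powerset.1 hX)).antisymm hMU)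
  · obtain ⟨m, hmM, hmU⟩ := Finset.not_subset.1 hMU
    obtain ⟨M, hm, rfl⟩ : ∃ M', m ∉ M' ∧ insert m M' = M :=
      ⟨M.erase m, Finset.notMem_erase m M, Finset.insert_erase hmM⟩
    rw [Finset.sum_powerset_insert hm, ← Finset.sum_add_distrib]
    refine Finset.sum_eq_zero fun X hX => ?_
    have hmX : m ∉ X := fun h => hm (Finset.mem_powerset.1 hX h)
    have h1 : (insert m M \ X).card = (M \ X).card + 1 := by
      rw [Finset.insert_sdiff_of_notMem _ hmX, Finset.card_insert_of_notMem]
      simp [hm]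
    have h2 : insert m M \ insert m X = M \ X := by
      ext i
      simp only [Finset.mem_sdiff, Finset.mem_insert, not_or]
      constructor
      · rintro ⟨h | h, h3, h4⟩
        exacts [absurd h h3, ⟨h, h4⟩]
      · rintro ⟨h, h4⟩
        exact ⟨Or.inr h, fun he => hm (he ▸ h), h4⟩
    have h3 : U ⊆ insert m X ↔ U ⊆ X := Finset.subset_insert_iff_of_notMem hmU
    rw [h1, h2, if_congr h3 rfl rfl, pow_succ]
    ring

/-- The uniform distribution on the subsets `X` of `M` for which `|M \ X|` is even (`ε = 1`) or odd
(`ε = -1`). The two have the same frequencies on all proper subsets of `M`. -/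
noncomputable def parityWeight {ι : Type*} [DecidableEq ι] (ε : ℝ) (M X : Finset ι) : ℝ :=
  (1 + ε * (-1) ^ (M \ X).card) / 2 ^ M.card

variable {ι : Type*} [DecidableEq ι] {M : Finset ι}

theorem parityWeight_nonneg {ε : ℝ} (hε : ε = 1 ∨ ε = -1) (X : Finset ι) :
    0 ≤ parityWeight ε M X := by
  refine div_nonneg ?_ (by positivity)
  rcases hε with rfl | rfl <;> rcases neg_one_pow_eq_or ℝ (M \ X).card with h | h <;>
    rw [h] <;> norm_num

theorem sum_parityWeight_superset {U : Finset ι} (ε : ℝ) (hUM : U ≠ M) :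
    ∑ X ∈ M.powerset, parityWeight ε M X * (if U ⊆ X then 1 else 0) =
      (∑ X ∈ M.powerset, if U ⊆ X then 1 else 0) / 2 ^ M.card := by
  have h : ∀ X, parityWeight ε M X * (if U ⊆ X then 1 else 0) =
      (if U ⊆ X then 1 else 0) / 2 ^ M.card +
        ε / 2 ^ M.card * ((-1 : ℝ) ^ (M \ X).card * (if U ⊆ X then 1 else 0)) := by
    intro X
    unfold parityWeight
    ring
  simp only [h, Finset.sum_add_distrib, ← Finset.mul_sum, sum_powerset_sign_superset hUM,
    mul_zero, add_zero, ← Finset.sum_div]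

theorem sum_parityWeight (ε : ℝ) (hM : M.Nonempty) :
    ∑ X ∈ M.powerset, parityWeight ε M X = 1 := by
  have := sum_parityWeight_superset ε hM.ne_empty.symm
  simpa using this

theorem sum_parityWeight_self (ε : ℝ) :
    ∑ X ∈ M.powerset, parityWeight ε M X * (if M ⊆ X then 1 else 0) =
      (1 + ε) / 2 ^ M.card := by
  rw [Finset.sum_eq_single M]
  · simp [parityWeight]
  · intro X hX hne
    rw [if_neg, mul_zero]
    exact fun h => hne ((Finset.mem_powerset.1 hX).antisymm h)
  · simp

variable [Fintype ι] {F : Set (Finset ι)} {C : Finset ι}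

/-- If the joint frequency of `a` and `b` is that of `a` alone, then `a` implies `b` almost surely. -/
theorem eq_true_of_distMean_eq {p : (ι → Bool) → ℝ} (hp : ∀ z, 0 ≤ p z) {a b : ι}
    (h : distMean p (itemsetIndicator {a, b}) = distMean p (itemsetIndicator {a}))
    {z : ι → Bool} (hz : p z ≠ 0) (ha : z a = true) : z b = true := by
  have h0 : ∑ y, p y * (itemsetIndicator {a} y - itemsetIndicator {a, b} y) = 0 := by
    simp only [mul_sub, Finset.sum_sub_distrib]
    unfold distMean at h
    rw [h, sub_self]
  have hnn : ∀ y ∈ Finset.univ,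
      0 ≤ p y * (itemsetIndicator {a} y - itemsetIndicator {a, b} y) := by
    intro y _
    refine mul_nonneg (hp y) ?_
    cases hya : y a <;> cases hyb : y b <;> simp [itemsetIndicator, hya, hyb]
  have h1 := (Finset.sum_eq_zero_iff_of_nonneg hnn).1 h0 z (Finset.mem_univ z)
  have h2 := (mul_eq_zero.1 h1).resolve_left hz
  by_contra hb
  simp [itemsetIndicator, ha, hb] at h2

/-- A nonempty set `M` of items bordering one component obstructs safety if it is not in `F`. The
frequencies come from the even distribution on `M`, with the items of the component set to one
exactly when all of `M` is. They force the component to imply `M`, so an extension gives `M`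
positive frequency; the odd distribution on `M` satisfies the same frequencies inside `C` and gives
`M` frequency zero. -/
theorem IsSafe.mem_of_avoidReach (hF : IsAntimonotonic F) (hC : IsSafe F C) {h : ι} (hh : h ∉ C)
    (hMC : M ⊆ C) (hM : M.Nonempty) (hreach : ∀ n ∈ M, AvoidReach F C h n) : M ∈ F := by
  classical
  by_contra hMF
  let Φ : Finset ι → ι → Bool := fun X i =>
    decide (if i ∈ C then i ∈ X else AvoidReach F C h i ∧ X = M)
  let Ψ : Finset ι → C → Bool := fun X i => decide (i.1 ∈ X)
  obtain ⟨p₀, hp₀, hmean₀⟩ := exists_pushforward M.powerset (parityWeight 1 M)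
    (fun X _ => parityWeight_nonneg (Or.inl rfl) X) (sum_parityWeight 1 hM) Φ
  obtain ⟨q, hq, hmeanq⟩ := exists_pushforward M.powerset (parityWeight (-1) M)
    (fun X _ => parityWeight_nonneg (Or.inr rfl) X) (sum_parityWeight (-1) hM) Ψ
  have hΨ : ∀ (V : Finset C) (X : Finset ι), itemsetIndicator V (Ψ X) =
      if V.map (Function.Embedding.subtype (· ∈ C)) ⊆ X then 1 else 0 := by
    intro V X
    simp [itemsetIndicator, Ψ, Finset.subset_iff]
  have hΦC : ∀ X, (fun i : C => Φ X i) = Ψ X := fun X => by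
    funext i
    simp [Φ, Ψ]
  let θ : F → ℝ := fun U => distMean p₀ (itemsetIndicator U.1)
  have hqθ : Satisfies (projFamily C F) (projFreq C θ) q := by
    rintro ⟨V, hV⟩
    have hVM : V.map (Function.Embedding.subtype (· ∈ C)) ≠ M := fun he => hMF (he ▸ hV)
    simp only [projFreq, θ, hmeanq, hmean₀, itemsetIndicator_map, hΦC, hΨ,
      sum_parityWeight_superset _ hVM]
  obtain ⟨p, hp, hpq, hpθ⟩ := hC θ ⟨p₀, hp₀, fun _ => rfl⟩ q hq hqθ
  have hpF : ∀ U ∈ F, distMean p (itemsetIndicator U) = distMean p₀ (itemsetIndicator U) :=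
    fun U hU => hpθ ⟨U, hU⟩
  -- Along a path in the component the value one propagates, and so it does into `M`.
  have hstep : ∀ x, AvoidReach F C h x → (x ∈ C → x ∈ M) →
      ∀ z, p z ≠ 0 → z h = true → z x = true := by
    intro x hx
    induction hx with
    | refl => exact fun _ z _ hz => hz
    | @tail a b hha hab ih =>
      obtain ⟨haC, hab⟩ := hab
      intro hb z hpz hzh
      have haz := ih (fun h => absurd h haC) z hpz hzh
      refine eq_true_of_distMean_eq hp.1 ?_ hpz haz
      rw [hpF _ hab, hpF {a} (hF _ hab _ (by simp)), hmean₀, hmean₀]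
      refine Finset.sum_congr rfl fun X _ => ?_
      have hha' : AvoidReach F C h a := hha
      have hhb' : AvoidReach F C h b := hha'.tail haC hab
      congr 1
      have himp : Φ X a = true → Φ X b = true := by
        simp only [Φ, decide_eq_true_eq, if_neg haC]
        rintro ⟨_, rfl⟩
        split_ifs with hbC
        · exact hb hbC
        · exact ⟨hhb', rfl⟩
      simp only [itemsetIndicator, Finset.forall_mem_insert, Finset.mem_singleton, forall_eq]
      exact if_congr ⟨fun h => h.1, fun h => ⟨h, himp h⟩⟩ rfl rfl
  have hhF : ({h} : Finset ι) ∈ F := by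
    obtain ⟨n, hn⟩ := hM
    rcases Relation.ReflTransGen.cases_head (hreach n hn) with he | ⟨b, hb, _⟩
    · exact absurd (hMC hn) (he ▸ hh)
    · exact hF _ hb.2 _ (by simp)
  have hpos : distMean p (itemsetIndicator {h}) ≠ 0 := by
    have hΦh : ∀ X ∈ M.powerset, parityWeight 1 M X * itemsetIndicator {h} (Φ X) =
        parityWeight 1 M X * (if M ⊆ X then 1 else 0) := by
      intro X hX
      have hXM : M ⊆ X ↔ X = M :=
        ⟨fun h => (Finset.mem_powerset.1 hX).antisymm h, fun h => h ▸ subset_rfl⟩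
      have hrefl : AvoidReach F C h h := Relation.ReflTransGen.refl
      simp [itemsetIndicator, Φ, hh, hrefl, hXM]
    rw [hpF _ hhF, hmean₀, Finset.sum_congr rfl hΦh, sum_parityWeight_self]
    positivity
  have hzero : distMean p (itemsetIndicator M) = 0 := by
    have hMmap : (M.subtype (· ∈ C)).map (Function.Embedding.subtype (· ∈ C)) = M :=
      Finset.subtype_map_of_mem hMC
    have h1 := distMean_marginal C p (itemsetIndicator (M.subtype (· ∈ C)))
    simp only [hpq, hmeanq, hΨ, ← itemsetIndicator_map, hMmap, sum_parityWeight_self] at h1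
    rw [← h1]
    norm_num
  obtain ⟨z, _, hz⟩ := Finset.exists_ne_zero_of_sum_ne_zero hpos
  have hpz : p z ≠ 0 := left_ne_zero_of_mul hz
  have hzh : z h = true := by
    by_contra hzh
    simp [itemsetIndicator, hzh] at hz
  have hzM : ∀ n ∈ M, z n = true := fun n hn => hstep n (hreach n hn) (fun _ => hn) z hpz hzh
  have h2 := (Finset.sum_eq_zero_iff_of_nonneg fun y _ =>
    mul_nonneg (hp.1 y) (itemsetIndicator_nonneg M y)).1 hzero z (Finset.mem_univ z)
  rw [itemsetIndicator, if_pos hzM, mul_one] at h2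
  exact hpz h2

theorem isSafe_iff_hasBoundariesIn (hF : IsAntimonotonic F) :
    IsSafe F C ↔ HasBoundariesIn F C :=
  ⟨fun hC _ hh _ hN hne hreach => hC.mem_of_avoidReach hF hh hN hne hreach,
    fun hC => hC.isSafe hF⟩

end Necessity

/-! ### The minimum safe set -/

theorem IsSafe.inter {ι : Type*} [Fintype ι] [DecidableEq ι] {F : Set (Finset ι)}
    (hF : IsAntimonotonic F) {C D : Finset ι} (hC : IsSafe F C) (hD : IsSafe F D) :
    IsSafe F (C ∩ D) := by
  rw [isSafe_iff_hasBoundariesIn hF] at *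
  exact hC.inter hD

theorem isSafe_univ {ι : Type*} [Fintype ι] [DecidableEq ι] {F : Set (Finset ι)}
    (hF : IsAntimonotonic F) : IsSafe F Finset.univ :=
  HasBoundariesIn.isSafe hF fun h hh => absurd (Finset.mem_univ h) hh

theorem IsMinimumSafe.subset {ι : Type*} [Fintype ι] [DecidableEq ι] {F : Set (Finset ι)}
    (hF : IsAntimonotonic F) {B C Y : Finset ι} (hC : IsMinimumSafe F B C) (hBY : B ⊆ Y)
    (hY : IsSafe F Y) : C ⊆ Y := by
  obtain ⟨hBC, hCs, hmin⟩ := hC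
  have hcard := hmin (C ∩ Y) (Finset.subset_inter hBC hBY) (hCs.inter hF hY)
  exact Finset.inter_eq_left.1 (Finset.eq_of_subset_of_card_le Finset.inter_subset_left hcard)

theorem mainTheorem5 {ι : Type*} [Fintype ι] [DecidableEq ι]
    (F : Set (Finset ι)) (hF : IsAntimonotonic F) (B : Finset ι) :
    (∃! C : Finset ι, IsMinimumSafe F B C) ∧
      ∀ C : Finset ι, IsMinimumSafe F B C →
        ∀ Y : Finset ι, B ⊆ Y → IsSafe F Y → C ⊆ Y := by
  classical
  refine ⟨?_, fun C hC Y hBY hY => hC.subset hF hBY hY⟩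
  obtain ⟨C, hC, hmin⟩ := Finset.exists_min_image
    (Finset.univ.filter fun C => B ⊆ C ∧ IsSafe F C) Finset.card
    ⟨Finset.univ, by simp [isSafe_univ hF]⟩
  simp only [Finset.mem_filter, Finset.mem_univ, true_and] at hC hmin
  have hCmin : IsMinimumSafe F B C := ⟨hC.1, hC.2, fun Y hBY hY => hmin Y ⟨hBY, hY⟩⟩
  exact ⟨C, hCmin, fun D hD =>
    (hD.subset hF hC.1 hC.2).antisymm (hCmin.subset hF hD.1 hD.2.1)⟩
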